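/- Let $G$ be a (not necessarily commutative) lattice-ordered group, written additively, with a strong unit $u$ (that is, $u\ge 0$ and for each $g\in G$ there is $n\ge 1$ with $g\le nu$). Let $M=\Gamma(G,u)$ be the pseudo MV-algebra on $[0,u]=\{x\in G: 0\le x\le u\}$ with constants $0$ and $u$ and with $x\oplus y=(x+y)\wedge u$, $x^-=u-x$, $x^\sim=-x+u$, and hence $x\odot y=(y^-\oplus x^-)^\sim=(x-u+y)\vee 0$. Assume that $M$ is representable, i.e. a subdirect product of linearly ordered pseudo MV-algebras; $M$ is not assumed to be symmetric (that is, $x^-=x^\sim$ for all $x$ is not required). Let $r:M\to M$ be a strict weak square root, that is, 1. $r(x)\odot r(x)=x$ for all $x\in M$; 2. for all $x,y\in M$, $y\odot y\le x$ implies $y\le r(x)$; 3. (strictness) $r(0)=r(0)^-$. Then for each $x\in M$ there is a unique element $h\in G$ with $h+h=x-u$, denoted $\frac{x-u}{2}$; moreover the element $\frac{x-u}{2}+u$ belongs to $M$, and $$r(x)=\frac{x-u}{2}+u .$$ Moreover, $M$ is two-divisible: for each $x\in M$ there is $y\in M$ such that the partial sum $y+y$ is defined in $M$ (i.e. $y\le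 y^-$, and then $y+y:=y\oplus y$) and $y+y=x$. -/

import Mathlib

universe u v

/-- The operations `⊕`, `⁻`, `∼`, `0`, `1` of a pseudo MV-algebra. -/
class PseudoMVOps (M : Type u) where
  oplus : M → M → M
  minus : M → M
  tilde : M → M
  zero : M
  one : M

namespace PseudoMVOps

/-- `x ⊙ y = (y⁻ ⊕ x⁻)∼`. -/
def odot {M : Type u} [PseudoMVOps M] (x y : M) : M :=
  tilde (oplus (minus y) (minus x))

end PseudoMVOps

open PseudoMVOps in
/-- Pseudo MV-algebras. -/
class PseudoMVAlgebra (M : Type u) extends PseudoMVOps M where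
  oplus_assoc : ∀ x y z : M, oplus x (oplus y z) = oplus (oplus x y) z
  oplus_zero : ∀ x : M, oplus x zero = x
  zero_oplus : ∀ x : M, oplus zero x = x
  oplus_one : ∀ x : M, oplus x one = one
  one_oplus : ∀ x : M, oplus one x = one
  minus_one : minus one = zero
  tilde_one : tilde one = zero
  tilde_minus_oplus : ∀ x y : M,
    tilde (oplus (minus x) (minus y)) = minus (oplus (tilde x) (tilde y))
  join_eq_swap : ∀ x y : M, oplus x (odot (tilde x) y) = oplus y (odot (tilde y) x)
  join_eq_right : ∀ x y : M, oplus y (odot (tilde y) x) = oplus (odot x (minus y)) y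
  join_eq_left : ∀ x y : M, oplus (odot x (minus y)) y = oplus (odot y (minus x)) x
  inf_eq : ∀ x y : M, odot x (oplus (minus x) y) = odot (oplus x (tilde y)) y
  tilde_minus : ∀ x : M, tilde (minus x) = x

namespace PseudoMVAlgebra

open PseudoMVOps

variable {M : Type u} {N : Type v} [PseudoMVAlgebra M] [PseudoMVAlgebra N]

/-- The lattice join `x ∨ y = x ⊕ (x∼ ⊙ y)`. -/
def join (x y : M) : M := oplus x (odot (tilde x) y)

/-- The lattice order: `x ≤ y` iff `x ∨ y = y`. -/
def le (x y : M) : Prop := join x y = y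

/-- The partial sum `x + y` is defined and equals `z`: it is defined iff `x ≤ y⁻`,
and then it is `x ⊕ y`. -/
def IsPartialSum (x y z : M) : Prop := le x (minus y) ∧ oplus x y = z

/-- Every element `x` is of the form `y + y` for the partial addition. -/
def TwoDivisible (M : Type u) [PseudoMVAlgebra M] : Prop :=
  ∀ x : M, ∃ y : M, IsPartialSum y y x

/-- The order is total. -/
def LinearlyOrdered (M : Type u) [PseudoMVAlgebra M] : Prop :=
  ∀ x y : M, le x y ∨ le y x

/-- Homomorphisms of pseudo MV-algebras. -/
structure IsHom (f : M → N) : Prop where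
  map_oplus : ∀ x y, f (oplus x y) = oplus (f x) (f y)
  map_minus : ∀ x, f (minus x) = minus (f x)
  map_tilde : ∀ x, f (tilde x) = tilde (f x)
  map_zero : f zero = zero
  map_one : f one = one

/-- `M` is a subdirect product of linearly ordered pseudo MV-algebras: there are surjective
homomorphisms `f i` onto linearly ordered ones which jointly separate the points of `M`.
(The factors are quotients of `M`, so the universe of `M` suffices.) -/
def Representable (M : Type u) [PseudoMVAlgebra M] : Prop :=
  ∃ (ι : Type u) (A : ι → Type u) (_ : ∀ i, PseudoMVAlgebra (A i)) (f : ∀ i, M → A i),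
    (∀ i, LinearlyOrdered (A i)) ∧ (∀ i, IsHom (f i)) ∧
    (∀ i, Function.Surjective (f i)) ∧ Function.Injective (fun (x : M) (i : ι) => f i x)

/-- Weak square roots. -/
structure IsWeakSquareRoot (r : M → M) : Prop where
  odot_self : ∀ x, odot (r x) (r x) = x
  le_of_odot_self_le : ∀ x y, le (odot y y) x → le y (r x)

/-- `r` is strict if `r(0) = r(0)⁻`. -/
def IsStrict (r : M → M) : Prop := r zero = minus (r zero)

end PseudoMVAlgebra

section Gamma

/-- A strong unit of the lattice-ordered group `G`. -/
structure StrongUnit (G : Type u) [AddGroup G] [Lattice G] where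
  val : G
  nonneg : 0 ≤ val
  exists_le_nsmul : ∀ g : G, ∃ n : ℕ, 1 ≤ n ∧ g ≤ n • val

/-- The underlying set `[0, e]` of `Γ(G, e)`. -/
@[ext]
structure Gamma {G : Type u} [AddGroup G] [Lattice G] (e : StrongUnit G) : Type u where
  val : G
  val_nonneg : 0 ≤ val
  val_le : val ≤ e.val

variable {G : Type u} [AddGroup G] [Lattice G]

variable [AddLeftMono G] [AddRightMono G]

/-- `x ⊕ y = (x + y) ∧ e`, `x⁻ = e - x`, `x∼ = -x + e`. -/
instance Gamma.instOps (e : StrongUnit G) : PseudoMVOps (Gamma e) where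
  oplus x y := ⟨(x.val + y.val) ⊓ e.val,
    le_inf (add_nonneg x.val_nonneg y.val_nonneg) e.nonneg, inf_le_right⟩
  minus x := ⟨e.val - x.val, sub_nonneg.2 x.val_le, sub_le_self _ x.val_nonneg⟩
  tilde x := ⟨-x.val + e.val, le_neg_add_iff_add_le.2 (by simpa using x.val_le),
    neg_add_le_iff_le_add.2 (le_add_of_nonneg_left x.val_nonneg)⟩
  zero := ⟨0, le_rfl, e.nonneg⟩
  one := ⟨e.val, e.nonneg, le_rfl⟩

open PseudoMVOps

theorem Gamma.val_oplus {e : StrongUnit G} (x y : Gamma e) :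
    (oplus x y).val = (x.val + y.val) ⊓ e.val := rfl

theorem Gamma.val_minus {e : StrongUnit G} (x : Gamma e) :
    (minus x).val = e.val - x.val := rfl

theorem Gamma.val_tilde {e : StrongUnit G} (x : Gamma e) :
    (tilde x).val = -x.val + e.val := rfl

theorem Gamma.val_zero {e : StrongUnit G} : (zero : Gamma e).val = 0 := rfl

theorem Gamma.val_one {e : StrongUnit G} : (one : Gamma e).val = e.val := rfl

theorem Gamma.val_odot {e : StrongUnit G} (x y : Gamma e) :
    (odot x y).val = (x.val - e.val + y.val) ⊔ 0 := by
  rw [odot, Gamma.val_tilde, Gamma.val_oplus, Gamma.val_minus, Gamma.val_minus, neg_inf, sup_add]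
  congr 1
  · simp only [sub_eq_add_neg, neg_add_rev, neg_neg, add_assoc, neg_add_cancel, add_zero]
  · simp

theorem Gamma.val_join {e : StrongUnit G} (x y : Gamma e) :
    (oplus x (odot (tilde x) y)).val = x.val ⊔ y.val := by
  rw [Gamma.val_oplus, Gamma.val_odot, Gamma.val_tilde, add_sub_cancel_right, add_sup,
    add_neg_cancel_left, add_zero, sup_comm, inf_eq_left.2 (sup_le x.val_le y.val_le)]

theorem Gamma.val_join' {e : StrongUnit G} (x y : Gamma e) :
    (oplus (odot x (minus y)) y).val = x.val ⊔ y.val := by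
  rw [Gamma.val_oplus, Gamma.val_odot, Gamma.val_minus, ← add_sub_assoc, sub_add_cancel, sup_add,
    sub_add_cancel, zero_add, inf_eq_left.2 (sup_le x.val_le y.val_le)]

/-- The pseudo MV-algebra `Γ(G, e)`. -/
instance Gamma.instPseudoMVAlgebra (e : StrongUnit G) : PseudoMVAlgebra (Gamma e) where
  oplus_assoc x y z := Gamma.ext <| by
    simp only [Gamma.val_oplus, add_inf, inf_add, inf_assoc, add_assoc]
    rw [inf_eq_right.2 (le_add_of_nonneg_left x.val_nonneg),
      inf_eq_right.2 (le_add_of_nonneg_right z.val_nonneg)]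
  oplus_zero x := Gamma.ext <| by
    rw [Gamma.val_oplus, Gamma.val_zero, add_zero, inf_eq_left.2 x.val_le]
  zero_oplus x := Gamma.ext <| by
    rw [Gamma.val_oplus, Gamma.val_zero, zero_add, inf_eq_left.2 x.val_le]
  oplus_one x := Gamma.ext <| by
    rw [Gamma.val_oplus, Gamma.val_one, inf_eq_right.2 (le_add_of_nonneg_left x.val_nonneg)]
  one_oplus x := Gamma.ext <| by
    rw [Gamma.val_oplus, Gamma.val_one, inf_eq_right.2 (le_add_of_nonneg_right x.val_nonneg)]
  minus_one := Gamma.ext <| by simp [Gamma.val_minus, Gamma.val_one, Gamma.val_zero]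
  tilde_one := Gamma.ext <| by simp [Gamma.val_tilde, Gamma.val_one, Gamma.val_zero]
  tilde_minus_oplus x y := Gamma.ext <| by
    simp only [Gamma.val_tilde, Gamma.val_oplus, Gamma.val_minus, neg_inf, sup_add,
      sub_eq_add_neg, add_sup, neg_add_rev, neg_neg, neg_add_cancel, add_neg_cancel, add_assoc,
      add_neg_cancel_left, add_zero]
  join_eq_swap x y := Gamma.ext <| by
    rw [Gamma.val_join, Gamma.val_join, sup_comm]
  join_eq_right x y := Gamma.ext <| by
    rw [Gamma.val_join, Gamma.val_join', sup_comm]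
  join_eq_left x y := Gamma.ext <| by
    rw [Gamma.val_join', Gamma.val_join', sup_comm]
  inf_eq x y := Gamma.ext <| by
    simp only [Gamma.val_odot, Gamma.val_oplus, Gamma.val_minus, Gamma.val_tilde, add_inf, inf_add,
      sub_eq_add_neg, add_assoc, neg_add_cancel_left, add_neg_cancel_left, neg_add_cancel,
      add_zero]
    rw [inf_comm]
  tilde_minus x := Gamma.ext <| by
    simp [Gamma.val_minus, Gamma.val_tilde]

end Gamma

/-- `h = g / 2`: `h` is the unique element of the group with `h + h = g`. -/
def IsHalf {G : Type u} [AddGroup G] (h g : G) : Prop :=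
  h + h = g ∧ ∀ k : G, k + k = g → k = h

/-! Existence: strictness makes `r 0` an exact solution of `s - e + s = 0`, and `r 0 ≤ r x`, so `r x
- e + r x` is already nonnegative and `h = r x - e` doubles to `x - e` (`Gamma.sub_add_self_eq`).
Uniqueness needs representability: if `h + h = k + k`, conjugation by `h` sends `h - k` to `k - h`,
hence the positive part of `h - k` to that of `k - h`. These parts are disjoint, and
representability makes disjointness stable under conjugation, so the latter part is disjoint from
itself and vanishes (`Gamma.le_of_add_self_eq`). -/

namespace PseudoMVAlgebra

open PseudoMVOps

/-! ### Pseudo MV-algebra arithmetic, meets and disjointness -/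

section Basic

variable {M : Type u} [PseudoMVAlgebra M]

theorem odot_one (x : M) : odot x one = x := by
  rw [odot, minus_one, zero_oplus, tilde_minus]

theorem one_odot (x : M) : odot one x = x := by
  rw [odot, minus_one, oplus_zero, tilde_minus]

theorem oplus_tilde_self (x : M) : oplus x (tilde x) = one := by
  have h := join_eq_swap x one
  rwa [odot_one, one_oplus] at h

theorem minus_oplus_self (x : M) : oplus (minus x) x = one := by
  have h := oplus_tilde_self (minus x)
  rwa [tilde_minus] at h

theorem minus_zero : minus (zero : M) = one := by
  rw [← oplus_zero (minus (zero : M)), minus_oplus_self]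

theorem tilde_zero : tilde (zero : M) = one := by
  rw [← minus_one, tilde_minus]

theorem minus_tilde (x : M) : minus (tilde x) = x := by
  have h := tilde_minus_oplus x one
  rwa [minus_one, tilde_one, oplus_zero, oplus_zero, tilde_minus, eq_comm] at h

theorem zero_odot (x : M) : odot zero x = zero := by
  rw [odot, minus_zero, oplus_one, tilde_one]

theorem tilde_odot_self (x : M) : odot (tilde x) x = zero := by
  rw [odot, minus_tilde, minus_oplus_self, tilde_one]

theorem odot_minus_self (x : M) : odot x (minus x) = zero := by
  rw [odot, minus_oplus_self, tilde_one]

/-- The lattice meet `x ∧ y = x ⊙ (x⁻ ⊕ y)`. -/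
def meet (x y : M) : M := odot x (oplus (minus x) y)

theorem zero_meet (x : M) : meet zero x = zero := zero_odot _

theorem meet_zero (x : M) : meet x zero = zero := by
  rw [meet, oplus_zero, odot_minus_self]

theorem meet_eq_left {x y : M} (h : le x y) : meet x y = x := by
  have h' : oplus x (odot (tilde x) y) = y := h
  rw [meet, ← h', oplus_assoc, minus_oplus_self, one_oplus, odot_one]

theorem meet_eq_right {x y : M} (h : le y x) : meet x y = y := by
  have h' : oplus y (odot (tilde y) x) = x := h
  rw [join_eq_right] at h'
  rw [meet, inf_eq]
  nth_rewrite 1 [← h']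
  rw [← oplus_assoc, oplus_tilde_self, oplus_one, one_odot]

theorem LinearlyOrdered.eq_zero_or_eq_zero (hM : LinearlyOrdered M) {x y : M}
    (h : meet x y = zero) : x = zero ∨ y = zero :=
  (hM x y).imp (fun hxy => (meet_eq_left hxy).symm.trans h)
    (fun hyx => (meet_eq_right hyx).symm.trans h)

end Basic

variable {M : Type u} {N : Type v} [PseudoMVAlgebra M] [PseudoMVAlgebra N]

theorem IsHom.map_odot {f : M → N} (hf : IsHom f) (x y : M) :
    f (odot x y) = odot (f x) (f y) := by
  simp only [odot, hf.map_tilde, hf.map_oplus, hf.map_minus]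

theorem IsHom.map_meet {f : M → N} (hf : IsHom f) (x y : M) :
    f (meet x y) = meet (f x) (f y) := by
  simp only [meet, hf.map_odot, hf.map_oplus, hf.map_minus]

/-- In a representable pseudo MV-algebra, disjointness from `y` passes to the truncated
conjugates of `y`. -/
theorem Representable.meet_conj_eq_zero (hM : Representable M) {x y : M}
    (h : meet x y = zero) (z : M) :
    meet x (odot (tilde z) (oplus y z)) = zero ∧
      meet x (odot (oplus (tilde z) (tilde (tilde y))) z) = zero := by
  obtain ⟨ι, A, _, f, hlin, hhom, -, hinj⟩ := hM
  -- Disjoint elements of a chain include a zero, and both truncated conjugates vanish together with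
  -- `y`.
  have key (i : ι) : f i x = zero ∨ f i y = zero :=
    (hlin i).eq_zero_or_eq_zero (by rw [← (hhom i).map_meet, h, (hhom i).map_zero])
  constructor <;> refine hinj (funext fun i => ?_) <;>
    simp only [(hhom i).map_meet, (hhom i).map_odot, (hhom i).map_oplus, (hhom i).map_tilde,
      (hhom i).map_zero] <;>
    rcases key i with hx | hy
  · rw [hx, zero_meet]
  · rw [hy, zero_oplus, tilde_odot_self, meet_zero]
  · rw [hx, zero_meet]
  · rw [hy, tilde_zero, tilde_one, oplus_zero, tilde_odot_self, meet_zero]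

end PseudoMVAlgebra

/-! ### Doubling and disjointness in lattice-ordered groups -/

section LatticeOrderedGroup

variable {G : Type u} [AddGroup G] [Lattice G] [AddLeftMono G] [AddRightMono G]

/-- The hypothesis says `-g ≤ g`, so `g = |g|`. -/
theorem nonneg_of_add_self_nonneg {g : G} (h : 0 ≤ g + g) : 0 ≤ g := by
  have h' : -g ≤ g := neg_le_iff_add_nonneg.2 h
  have := abs_nonneg g
  rwa [abs, sup_eq_left.2 h'] at this

theorem nonpos_of_add_self_nonpos {g : G} (h : g + g ≤ 0) : g ≤ 0 := by
  rw [← neg_nonneg] at h ⊢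
  exact nonneg_of_add_self_nonneg (by rwa [neg_add_rev] at h)

theorem eq_zero_of_inf_eq_zero_of_le_add {w p q : G} (hq : 0 ≤ q)
    (hwp : w ⊓ p = 0) (hwq : w ⊓ q = 0) (hle : w ≤ p + q) : w = 0 := by
  have h : w - q ≤ w ⊓ p := le_inf (sub_le_self _ hq) (sub_le_iff_le_add.2 hle)
  rw [hwp, sub_nonpos] at h
  rwa [inf_eq_left.2 h] at hwq

theorem sub_sup_zero_inf_sub_sup_zero (h k : G) : ((h - k) ⊔ 0) ⊓ ((k - h) ⊔ 0) = 0 := by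
  have := posPart_inf_negPart_eq_zero (h - k)
  rwa [posPart_def, negPart_def, neg_sub] at this

end LatticeOrderedGroup

/-! ### Transfer to the unit interval and uniqueness of halves -/

namespace Gamma

open PseudoMVOps PseudoMVAlgebra

variable {G : Type u} [AddGroup G] [Lattice G] [AddLeftMono G] [AddRightMono G]
  {e : StrongUnit G}

theorem val_meet (x y : Gamma e) : (meet x y).val = x.val ⊓ y.val := by
  simp only [meet, val_odot, val_oplus, val_minus, add_inf, sub_eq_add_neg, add_assoc,
    neg_add_cancel_left, add_neg_cancel_left, neg_add_cancel, add_zero]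
  rw [inf_comm, sup_eq_left.2 (le_inf x.val_nonneg y.val_nonneg)]

theorem le_iff {x y : Gamma e} : PseudoMVAlgebra.le x y ↔ x.val ≤ y.val := by
  rw [PseudoMVAlgebra.le, Gamma.ext_iff, join, val_join, sup_eq_right]

/-- The full conjugate may leave `[0, e]`, so only its truncations at `-z + e` and at `z` come from
the algebra. The two bounds suffice because `z + (-z + e) = e` dominates `x`. -/
theorem inf_conj_eq_zero (hM : Representable (Gamma e)) {x y : Gamma e}
    (h : x.val ⊓ y.val = 0) (z : Gamma e) : x.val ⊓ (-z.val + y.val + z.val) = 0 := by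
  have hxy : meet x y = zero := Gamma.ext (by rw [val_meet, h, val_zero])
  obtain ⟨h₁, h₂⟩ := hM.meet_conj_eq_zero hxy z
  have hc : 0 ≤ -z.val + y.val + z.val := by
    have := add_le_add_left (add_le_add_right y.val_nonneg (-z.val)) z.val
    simpa using this
  have ht : 0 ≤ -z.val + e.val := (tilde z).val_nonneg
  have e₁ : (odot (tilde z) (oplus y z)).val =
      (-z.val + y.val + z.val) ⊓ (-z.val + e.val) := by
    rw [val_odot, val_tilde, val_oplus, add_sub_cancel_right, add_inf, ← add_assoc,
      sup_eq_left.2 (le_inf hc ht)]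
  have e₂ : (odot (oplus (tilde z) (tilde (tilde y))) z).val =
      (-z.val + y.val + z.val) ⊓ z.val := by
    rw [val_odot, val_oplus, val_tilde, val_tilde, val_tilde, sub_eq_add_neg, inf_add, inf_add,
      ← sup_eq_left.2 (le_inf hc z.val_nonneg)]
    simp [add_assoc]
  have h₁' := congrArg Gamma.val h₁
  have h₂' := congrArg Gamma.val h₂
  rw [val_meet, val_zero, e₁, ← inf_assoc] at h₁'
  rw [val_meet, val_zero, e₂, ← inf_assoc] at h₂'
  refine eq_zero_of_inf_eq_zero_of_le_add ht h₂' h₁' ?_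
  rw [add_neg_cancel_left]
  exact inf_le_left.trans x.val_le

theorem le_of_add_self_eq (hM : Representable (Gamma e)) {h k : G}
    (hh : h ∈ Set.Icc (-e.val) 0) (hk : k ∈ Set.Icc (-e.val) 0) (hhk : h + h = k + k) :
    k ≤ h := by
  have bound {a b : G} (ha : a ≤ 0) (hb : -e.val ≤ b) : (a - b) ⊔ 0 ≤ e.val := by
    refine sup_le ?_ e.nonneg
    rw [sub_eq_add_neg]
    exact (add_le_of_nonpos_left ha).trans (neg_le.1 hb)
  -- The positive and negative parts of `h - k`, with the conjugator `-h`, all lie in `[0, e]`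
  -- because `h` and `k` lie in `[-e, 0]`.
  let a : Gamma e := ⟨(h - k) ⊔ 0, le_sup_right, bound hh.2 hk.1⟩
  let b : Gamma e := ⟨(k - h) ⊔ 0, le_sup_right, bound hk.2 hh.1⟩
  let g : Gamma e := ⟨-h, neg_nonneg.2 hh.2, neg_le.1 hh.1⟩
  have hsub : h + (h - k) - h = k - h := by
    rw [← add_sub_assoc, hhk, add_sub_cancel_right]
  have hconj : -g.val + a.val + g.val = b.val := by
    change -(-h) + ((h - k) ⊔ 0) + -h = (k - h) ⊔ 0
    rw [neg_neg, add_sup, sup_add, ← sub_eq_add_neg, hsub, add_zero, add_neg_cancel]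
  have hba : b.val ⊓ a.val = 0 := sub_sup_zero_inf_sub_sup_zero k h
  have hb := inf_conj_eq_zero hM hba g
  rw [hconj, inf_idem] at hb
  exact sub_nonpos.1 (sup_eq_right.1 hb)

theorem mem_Icc_of_add_self {h : G} (x : Gamma e) (hx : h + h = x.val - e.val) :
    h ∈ Set.Icc (-e.val) 0 := by
  have h0 : h ≤ 0 := nonpos_of_add_self_nonpos (hx.trans_le (sub_nonpos.2 x.val_le))
  refine ⟨?_, h0⟩
  calc -e.val ≤ x.val - e.val := by
        rw [sub_eq_add_neg]; exact le_add_of_nonneg_left x.val_nonneg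
    _ = h + h := hx.symm
    _ ≤ h := add_le_of_nonpos_left h0

theorem isHalf_of_add_self_eq (hM : Representable (Gamma e)) {h : G} (x : Gamma e)
    (hx : h + h = x.val - e.val) : IsHalf h (x.val - e.val) :=
  have mem := mem_Icc_of_add_self x hx
  ⟨hx, fun _ hk => le_antisymm
    (le_of_add_self_eq hM mem (mem_Icc_of_add_self x hk) (hx.trans hk.symm))
    (le_of_add_self_eq hM (mem_Icc_of_add_self x hk) mem (hk.trans hx.symm))⟩

/-- For a strict weak square root, the truncation in `r(x) ⊙ r(x) = x` is inessential. -/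
theorem sub_add_self_eq {r : Gamma e → Gamma e} (hr : IsWeakSquareRoot r) (hs : IsStrict r)
    (x : Gamma e) : ((r x).val - e.val) + ((r x).val - e.val) = x.val - e.val := by
  have hs' : (r zero).val = e.val - (r zero).val := congrArg Gamma.val hs
  have h0 : (r zero).val - e.val + (r zero).val = 0 := by
    nth_rewrite 1 [hs']
    rw [eq_sub_iff_add_eq] at hs'
    rw [← hs']
    simp
  have hle : (r zero).val ≤ (r x).val := le_iff.1 <| hr.le_of_odot_self_le x _ <| by
    rw [hr.odot_self, le_iff]
    exact x.val_nonneg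
  have hx : (r x).val - e.val + (r x).val = x.val := by
    have := congrArg Gamma.val (hr.odot_self x)
    rwa [val_odot, sup_eq_left.2] at this
    -- The untruncated product for `r x` dominates the one for `r 0`, which is zero.
    rw [← h0]
    exact add_le_add (sub_le_sub_right hle _) hle
  rw [← add_sub_assoc, hx]

end Gamma

theorem mainTheorem8 {G : Type u} [AddGroup G] [Lattice G] [AddLeftMono G] [AddRightMono G]
    (e : StrongUnit G) (hM : PseudoMVAlgebra.Representable (Gamma e))
    (r : Gamma e → Gamma e) (hr : PseudoMVAlgebra.IsWeakSquareRoot r)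
    (hs : PseudoMVAlgebra.IsStrict r) :
    (∀ x : Gamma e, ∃ h : G, IsHalf h (x.val - e.val) ∧
      h + e.val ∈ Set.Icc (0 : G) e.val ∧ (r x).val = h + e.val) ∧
    PseudoMVAlgebra.TwoDivisible (Gamma e) := by
  refine ⟨fun x => ⟨(r x).val - e.val,
    Gamma.isHalf_of_add_self_eq hM x (Gamma.sub_add_self_eq hr hs x), ?_, ?_⟩, fun x => ?_⟩
  · rw [sub_add_cancel]
    exact ⟨(r x).val_nonneg, (r x).val_le⟩
  · rw [sub_add_cancel]
  · have hy := Gamma.sub_add_self_eq hr hs (PseudoMVOps.tilde x)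
    -- Since `x∼ - e = -x`, the negative of its half, `e - r (x∼)`, is a half of `x`.
    let y : Gamma e := PseudoMVOps.minus (r (PseudoMVOps.tilde x))
    have hyy : y.val + y.val = x.val := by
      have := congrArg Neg.neg hy
      rwa [neg_add_rev, neg_sub, Gamma.val_tilde, add_sub_cancel_right,
        neg_neg] at this
    refine ⟨y, Gamma.le_iff.2 ?_, Gamma.ext ?_⟩
    · rw [Gamma.val_minus y, le_sub_iff_add_le, hyy]
      exact x.val_le
    · rw [Gamma.val_oplus, hyy, inf_eq_left.2 x.val_le]
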